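/- Let $0\le r\le d$, let $V=\mathbb{C}_{<d}[u]$ be the space of complex polynomials of degree less than $d$, and let $\mathrm{Gr}(r,d)$ be the Grassmannian of $r$-dimensional subspaces of $V$ with its classical topology. For $z\in\mathbb{C}$ let $\mathcal{F}(z)$ be the flag with members $\mathcal{F}(z)_k=(u-z)^{d-k}\,\mathbb{C}_{<k}[u]$, and let $\mathcal{F}(\infty)_k=\mathbb{C}_{<k}[u]$, $0\le k\le d$. For a partition $\lambda$ with at most $r$ rows and at most $d-r$ columns and $z\in\mathbb{C}\cup\{\infty\}$, the Schubert cell $\Omega^\circ(\lambda;z)$ is the set of $W\in\mathrm{Gr}(r,d)$ such that $$\dim(W\cap\mathcal{F}(z)_k)=\#\{1\le s\le r : d-r+s-\lambda_s\le k\}\quad\text{for all }k,$$ and the Schubert variety $\Omega(\lambda;z)$ is its closure. Let $\lambda^c=(d-r-\lambda_r,\dots,d-r-\lambda_1)$, let $\square=(1)$, and put $$\Omega(\square^n,\mu^c;z_1,\dots,z_n,\infty)=\Omega(\square;z_1)\cap\dots\cap\Omega(\square;z_n)\cap\Omega(\mu^c;\infty).$$ Let $n\ge 1$, let $\mu$ be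 a partition of $n$ with at most $r$ rows and at most $d-r$ columns, let $z_1<\dots<z_n$ be real numbers, and let $X\in\Omega(\square^n,\mu^c;z_1,\dots,z_n,\infty)$. Let $s\mapsto X(s)$, $s\in[z_n,\infty)$, be a continuous family in $\mathrm{Gr}(r,d)$ such that $X(z_n)=X$ and $X(s)\in\Omega(\square^n,\mu^c;z_1,\dots,z_{n-1},s,\infty)$ for all $s\ge z_n$. Then the limit $X_\infty=\lim_{s\to\infty}X(s)$ exists in $\mathrm{Gr}(r,d)$, and there is a partition $\lambda\subset\mu$ with $|\lambda|=|\mu|-1$ such that $$X_\infty\in\Omega^\circ(\lambda^c;\infty)\quad\text{and}\quad X_\infty\in\Omega(\square^{n-1},\lambda^c;z_1,\dots,z_{n-1},\infty).$$ -/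

import Mathlib

open Polynomial Filter Topology OnePoint

noncomputable section

namespace SchubertLimit

/-- The Grassmannian `Gr(r, d)` of `r`-dimensional subspaces of the `d`-dimensional space
`ℂ_{<d}[u]` of complex polynomials of degree less than `d`. -/
@[ext]
structure Gr (r d : ℕ) where
  /-- the underlying subspace -/
  carrier : Submodule ℂ ℂ[X]
  le_degreeLT : carrier ≤ degreeLT ℂ d
  finrank_eq : Module.finrank ℂ carrier = r

/-- The polynomial `∑ j, a j * u ^ j` with coefficient vector `a`, as a linear map. -/
def polyOfCoeffs (d : ℕ) : (Fin d → ℂ) →ₗ[ℂ] ℂ[X] :=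
  (degreeLT ℂ d).subtype ∘ₗ (degreeLTEquiv ℂ d).symm.toLinearMap

theorem polyOfCoeffs_injective (d : ℕ) : Function.Injective (polyOfCoeffs d) :=
  Subtype.val_injective.comp (degreeLTEquiv ℂ d).symm.injective

/-- Linearly independent `r`-tuples of (coefficient vectors of) polynomials of degree less than
`d`, with the topology of a subset of `ℂ ^ (r * d)`. -/
abbrev Frame (r d : ℕ) : Type :=
  {f : Fin r → Fin d → ℂ // LinearIndependent ℂ f}

/-- The subspace spanned by a frame. -/
def spanGr {r d : ℕ} (f : Frame r d) : Gr r d where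
  carrier := Submodule.span ℂ (Set.range fun i => polyOfCoeffs d (f.1 i))
  le_degreeLT := by
    rw [Submodule.span_le]
    rintro _ ⟨i, rfl⟩
    exact ((degreeLTEquiv ℂ d).symm (f.1 i)).2
  finrank_eq := by
    have h : LinearIndependent ℂ (fun i => polyOfCoeffs d (f.1 i)) :=
      f.2.map' (polyOfCoeffs d) (LinearMap.ker_eq_bot.2 (polyOfCoeffs_injective d))
    simpa using finrank_span_eq_card h

/-- The classical topology of the Grassmannian: the quotient topology of the space of frames. -/
instance (r d : ℕ) : TopologicalSpace (Gr r d) :=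
  TopologicalSpace.coinduced (spanGr (r := r) (d := d)) inferInstance

/-- The osculating flag at a point of `ℙ¹ = ℂ ∪ {∞}`: its `k`-th member (`0 ≤ k ≤ d`) is
`(u - z) ^ (d - k) * ℂ_{<k}[u]` at a finite point `z`, and `ℂ_{<k}[u]` at `∞`. -/
def oscFlag (d : ℕ) : OnePoint ℂ → ℕ → Submodule ℂ ℂ[X]
  | OnePoint.infty, k => degreeLT ℂ k
  | OnePoint.some z, k => (degreeLT ℂ k).map (LinearMap.mulLeft ℂ ((X - C z) ^ (d - k)))

/-- `lam` has at most `r` rows and at most `c` columns. -/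
def FitsIn (r c : ℕ) (lam : YoungDiagram) : Prop :=
  ∀ x ∈ lam, x.1 < r ∧ x.2 < c

/-- The partition with a single box. -/
def box : YoungDiagram where
  cells := {(0, 0)}
  isLowerSet := by
    intro a b hba ha
    simp only [Finset.coe_singleton, Set.mem_singleton_iff] at ha ⊢
    subst ha
    exact Prod.ext (Nat.le_zero.1 hba.1) (Nat.le_zero.1 hba.2)

/-- The complementary partition in the `r × c` rectangle: the complement of the diagram in the
rectangle, rotated by 180 degrees. -/
def compl (r c : ℕ) (mu : YoungDiagram) : YoungDiagram where
  cells := {x ∈ Finset.range r ×ˢ Finset.range c | (r - 1 - x.1, c - 1 - x.2) ∉ mu}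
  isLowerSet := by
    rintro ⟨i, j⟩ ⟨i', j'⟩ hle h
    obtain ⟨hi, hj⟩ : i' ≤ i ∧ j' ≤ j := hle
    simp only [Finset.coe_filter, Finset.mem_product, Finset.mem_range, Set.mem_ofPred_eq] at h ⊢
    refine ⟨⟨by omega, by omega⟩, fun hmem => h.2 ?_⟩
    exact mu.up_left_mem (by omega) (by omega) hmem

/-- The open Schubert cell of a partition `lam` (contained in the `r × (d - r)` rectangle) at the
osculating flag of `z`: the `W` with
`dim (W ∩ F_k) = #{1 ≤ s ≤ r | d - r + s - lam_s ≤ k}` for all `k`.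
Rows are numbered from `0` here, so that `lam_s` is `lam.rowLen (s - 1)`. -/
def schubertCell (r d : ℕ) (lam : YoungDiagram) (z : OnePoint ℂ) : Set (Gr r d) :=
  {W | ∀ k : ℕ, Module.finrank ℂ (W.carrier ⊓ oscFlag d z k : Submodule ℂ ℂ[X]) =
    ((Finset.range r).filter fun s => d - r + (s + 1) - lam.rowLen s ≤ k).card}

/-- The Schubert variety: the closure of the Schubert cell. -/
def schubertVariety (r d : ℕ) (lam : YoungDiagram) (z : OnePoint ℂ) : Set (Gr r d) :=
  closure (schubertCell r d lam z)

/-- The intersection `Ω(□ⁿ, muᶜ; z₁, …, zₙ, ∞)`. -/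
def schubertIntersection (r d : ℕ) {n : ℕ} (mu : YoungDiagram) (z : Fin n → ℂ) :
    Set (Gr r d) :=
  (⋂ i, schubertVariety r d box (z i : OnePoint ℂ)) ∩
    schubertVariety r d (compl r (d - r) mu) ∞

end SchubertLimit

end

/-!
The proof follows the Wronskian `Wr(W)` of a subspace `W`, a polynomial determined up to a scalar.

A subspace in the Schubert variety of a single box at `z` has a Wronskian vanishing at `z`, and
every subspace lies in the cell at infinity of the complement of some partition `lam`, with
`deg Wr(W) = |lam|`; if it lies in the Schubert variety of the complement of `mu`, then `lam ⊆ mu`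
(`exists_mem_schubertCell`). Counting roots against the degree gives
`Wr(X(s)) ∝ (u - s) * g` with `g = ∏ (u - z i)`, the product over the points that stay fixed
(`wronskiDet_eq_of_mem_schubertIntersection`), so every cluster point of `X(s)` for `s → ∞` has
Wronskian proportional to `g` (`exists_wronskiDet_eq_of_mapClusterPt`).

Only finitely many subspaces have a given Wronskian (`finite_setOf_wronskiDet_eq`). The Wronskian
of independent polynomials is nonzero, so by compactness of the Grassmannian the maximal minors are
bounded on the set of all frames with Wronskian exactly `g`. This set is an affine algebraic set,
on which a bounded polynomial takes finitely many values (`finite_values_of_bounded`); and the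
maximal minors determine the subspace.

A path in a compact Hausdorff space with finitely many cluster points converges
(`exists_tendsto_of_finite_clusterPts`). The limit lies in the closed conditions satisfied by all
`X(s)`, and in the cell of the complement of a partition of size `deg g = |mu| - 1`.

Continuous functions on the Grassmannian are obtained from generalized Plücker coordinates
`A ↦ det (A * E)` of frames: products of one coordinate with the conjugate of another, normalized
by the sum of the squared absolute values of the maximal minors (`pairing`). They separate points,
whence the Hausdorff property, and include the values of the Wronskian.
-/

namespace SchubertLimit

/-! ### Bounded polynomial functions on affine algebraic sets -/

/-- A polynomial function that is bounded on an affine algebraic set over `ℂ` takes only finitely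
many values there. If `c` is not a value of `p`, then `p - c` is invertible modulo the ideal, by the
Nullstellensatz; a bounded `p` gives uncountably many such inverses, which are linearly dependent
because the polynomial ring has countable dimension, and clearing denominators in a linear relation
shows that the values of `p` are roots of a nonzero polynomial in one variable. -/
theorem finite_values_of_bounded {σ : Type} [Finite σ] (S : Set (MvPolynomial σ ℂ))
    (p : MvPolynomial σ ℂ) (R : ℝ)
    (hR : ∀ x : σ → ℂ, (∀ q ∈ S, MvPolynomial.aeval x q = 0) → ‖MvPolynomial.aeval x p‖ ≤ R) :
    {w : ℂ | ∃ x : σ → ℂ, (∀ q ∈ S, MvPolynomial.aeval x q = 0) ∧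
      MvPolynomial.aeval x p = w}.Finite := by
  -- the inverse of `p - t` modulo the ideal, for the real numbers `t` beyond the bound
  have key : ∀ t : Set.Ioi (max R 0), ∃ q : MvPolynomial σ ℂ, ∀ x : σ → ℂ,
      (∀ q ∈ S, MvPolynomial.aeval x q = 0) →
      MvPolynomial.aeval x q * (MvPolynomial.aeval x p - ((t : ℝ) : ℂ)) = 1 := by
    intro t
    have ht : max R 0 < (t : ℝ) := t.2
    have h0 : 0 < (t : ℝ) := (le_max_right _ _).trans_lt ht
    have hempty : MvPolynomial.zeroLocus ℂ
        (Ideal.span (insert (p - MvPolynomial.C ((t : ℝ) : ℂ)) S)) = ∅ := by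
      rw [MvPolynomial.zeroLocus_span, Set.eq_empty_iff_forall_notMem]
      intro x hx
      have h1 := hx _ (Set.mem_insert _ _)
      have h2 := hR x (fun q hq => hx q (Set.mem_insert_of_mem _ hq))
      rw [map_sub, MvPolynomial.aeval_C, sub_eq_zero] at h1
      rw [h1] at h2
      simp only [Algebra.algebraMap_self, RingHom.id_apply, Complex.norm_real, Real.norm_eq_abs,
        abs_of_pos h0] at h2
      exact absurd ((le_max_left _ _).trans_lt ht) (not_lt.2 h2)
    have hrad := MvPolynomial.vanishingIdeal_zeroLocus_eq_radical (k := ℂ) (K := ℂ)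
      (Ideal.span (insert (p - MvPolynomial.C ((t : ℝ) : ℂ)) S))
    rw [hempty, MvPolynomial.vanishingIdeal_empty] at hrad
    have hone := Ideal.radical_eq_top.1 hrad.symm
    have h1 : (1 : MvPolynomial σ ℂ) ∈
        Ideal.span (insert (p - MvPolynomial.C ((t : ℝ) : ℂ)) S) := by rw [hone]; trivial
    obtain ⟨a, b, hb, hab⟩ := Ideal.mem_span_insert.1 h1
    refine ⟨a, fun x hx => ?_⟩
    have hbx : MvPolynomial.aeval x b = 0 := by
      have : x ∈ MvPolynomial.zeroLocus ℂ (Ideal.span S) := by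
        rw [MvPolynomial.zeroLocus_span]; exact hx
      exact this b hb
    have := congrArg (MvPolynomial.aeval x) hab
    simp only [map_one, map_add, map_mul, map_sub, MvPolynomial.aeval_C, hbx, add_zero] at this
    exact this.symm
  choose q hq using key
  have hdep : ¬ LinearIndependent ℂ q := by
    intro hli
    have h1 := hli.cardinal_lift_le_rank
    rw [← (MvPolynomial.basisMonomials σ ℂ).mk_eq_rank''] at h1
    have h2 : Cardinal.mk (σ →₀ ℕ) ≤ Cardinal.aleph0 := Cardinal.mk_le_aleph0
    rw [Cardinal.mk_Ioi_real, Cardinal.lift_id, Cardinal.lift_id] at h1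
    exact absurd (h1.trans h2) (not_le.2 Cardinal.aleph0_lt_continuum)
  rw [not_linearIndependent_iff] at hdep
  obtain ⟨s, a, hsum, i, his, hai⟩ := hdep
  classical
  -- the linear relation between the inverses, multiplied by the product of all `p - k`
  set P : ℂ[X] := ∑ j ∈ s, C (a j) * ∏ k ∈ s.erase j, (X - C ((k : ℝ) : ℂ)) with hP
  have hP0 : P ≠ 0 := by
    intro h
    have h1 : P.eval ((i : ℝ) : ℂ) = 0 := by rw [h, eval_zero]
    rw [hP, eval_finsetSum, Finset.sum_eq_single_of_mem i his] at h1
    · simp only [eval_mul, eval_C, eval_prod, eval_sub, eval_X, mul_eq_zero, hai, false_or,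
        Finset.prod_eq_zero_iff] at h1
      obtain ⟨k, hk, hk'⟩ := h1
      rw [sub_eq_zero, Complex.ofReal_inj] at hk'
      exact (Finset.mem_erase.1 hk).1 (Subtype.ext hk'.symm)
    · intro j _ hj
      simp only [eval_mul, eval_C, eval_prod, eval_sub, eval_X]
      rw [Finset.prod_eq_zero (Finset.mem_erase.2 ⟨hj.symm, his⟩) (sub_self _), mul_zero]
  refine (P.roots.toFinset.finite_toSet).subset ?_
  rintro w ⟨x, hx, rfl⟩
  simp only [Finset.mem_coe, Multiset.mem_toFinset, mem_roots hP0, IsRoot.def]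
  have h1 := congrArg (MvPolynomial.aeval x) hsum
  simp only [map_sum, _root_.map_smul, map_zero, smul_eq_mul] at h1
  rw [hP, eval_finsetSum]
  calc _ = ∑ j ∈ s, (∏ k ∈ s, (MvPolynomial.aeval x p - ((k : ℝ) : ℂ))) *
        (a j * MvPolynomial.aeval x (q j)) := by
        refine Finset.sum_congr rfl fun j hj => ?_
        simp only [eval_mul, eval_C, eval_prod, eval_sub, eval_X]
        rw [← Finset.mul_prod_erase s _ hj]
        linear_combination (-a j * ∏ k ∈ s.erase j, (MvPolynomial.aeval x p - ((k : ℝ) : ℂ))) *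
          hq j x hx
    _ = 0 := by rw [← Finset.mul_sum, h1, mul_zero]

/-! ### Limits of paths with finitely many cluster points -/

/-- A path `[a, ∞) → Y` in a compact Hausdorff space whose cluster points at `∞` form a finite set
converges: it eventually stays in the union of disjoint neighbourhoods of the cluster points,
hence in a single one of them by connectedness. -/
theorem exists_tendsto_of_finite_clusterPts {Y : Type*} [TopologicalSpace Y] [CompactSpace Y]
    [T2Space Y] {f : ℝ → Y} {a : ℝ} (hf : ContinuousOn f (Set.Ici a))
    (hfin : {y | MapClusterPt y atTop f}.Finite) : ∃ y, Tendsto f atTop (𝓝 y) := by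
  obtain ⟨U, hU, hdisj⟩ := hfin.t2_separation
  obtain ⟨y, hy⟩ : ∃ y, MapClusterPt y atTop f := exists_clusterPt_of_compactSpace (map f atTop)
  -- the path eventually lies in the union of the chosen neighbourhoods
  have hev : ∀ᶠ s in atTop, ∃ y, MapClusterPt y atTop f ∧ f s ∈ U y := by
    by_contra hcon
    rw [not_eventually] at hcon
    have hclosed : IsClosed {x | ¬ ∃ y, MapClusterPt y atTop f ∧ x ∈ U y} := by
      rw [← isOpen_compl_iff]
      have : {x | ¬ ∃ y, MapClusterPt y atTop f ∧ x ∈ U y}ᶜ =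
          ⋃ y ∈ {y | MapClusterPt y atTop f}, U y := by ext; simp
      rw [this]
      exact isOpen_biUnion fun y _ => (hU y).2
    obtain ⟨x, hx, hxc⟩ := hclosed.isCompact.exists_mapClusterPt_of_frequently hcon
    exact hx ⟨x, hxc, (hU x).1⟩
  obtain ⟨T, hT⟩ := eventually_atTop.1 hev
  have hconn : IsPreconnected (f '' Set.Ici (max T a)) :=
    isPreconnected_Ici.image _ (hf.mono (Set.Ici_subset_Ici.2 (le_max_right _ _)))
  have hsub : f '' Set.Ici (max T a) ⊆ U y := by
    refine hconn.subset_left_of_subset_union (v := ⋃ z ∈ {z | MapClusterPt z atTop f ∧ z ≠ y}, U z)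
      (hU y).2 (isOpen_biUnion fun z _ => (hU z).2) ?_ ?_ ?_
    · rw [Set.disjoint_iUnion₂_right]
      exact fun z hz => hdisj hy hz.1 hz.2.symm
    · rintro _ ⟨s, hs, rfl⟩
      obtain ⟨z, hz, hsz⟩ := hT s ((le_max_left _ _).trans hs)
      by_cases h : z = y
      · exact Or.inl (h ▸ hsz)
      · exact Or.inr (Set.mem_biUnion (show z ∈ {z | MapClusterPt z atTop f ∧ z ≠ y} from ⟨hz, h⟩)
          hsz)
    · obtain ⟨s, hs, hs'⟩ := ((mapClusterPt_iff_frequently.1 hy _ ((hU y).2.mem_nhds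
        (hU y).1)).and_eventually (eventually_ge_atTop (max T a))).exists
      exact ⟨f s, ⟨s, hs', rfl⟩, hs⟩
  refine ⟨y, le_nhds_of_unique_clusterPt fun y' hy' => ?_⟩
  by_contra hne
  obtain ⟨s, hs, hs'⟩ := ((mapClusterPt_iff_frequently.1 hy' _ ((hU y').2.mem_nhds
    (hU y').1)).and_eventually (eventually_ge_atTop (max T a))).exists
  exact Set.disjoint_left.1 (hdisj hy' hy hne) hs (hsub ⟨s, hs', rfl⟩)

/-! ### Frames and the subspaces they span -/

theorem polyOfCoeffs_apply (d : ℕ) (a : Fin d → ℂ) :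
    polyOfCoeffs d a = ∑ k : Fin d, monomial k (a k) := rfl

theorem exists_polyOfCoeffs_eq {d : ℕ} {f : ℂ[X]} (hf : f ∈ degreeLT ℂ d) :
    ∃ a, polyOfCoeffs d a = f :=
  ⟨degreeLTEquiv ℂ d ⟨f, hf⟩, by simp [polyOfCoeffs]⟩

theorem Gr.finite {r d : ℕ} (W : Gr r d) : Module.Finite ℂ W.carrier :=
  Module.Finite.of_injective (Submodule.inclusion W.le_degreeLT)
    (Submodule.inclusion_injective W.le_degreeLT)

variable {r d : ℕ}

/-- An independent family of `r` members of `W` spans `W`. -/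
theorem spanGr_eq_of_mem (f : Frame r d) (W : Gr r d)
    (h : ∀ i, polyOfCoeffs d (f.1 i) ∈ W.carrier) : spanGr f = W := by
  have := W.finite
  refine Gr.ext (Submodule.eq_of_le_of_finrank_eq ?_ ?_)
  · rw [spanGr, Submodule.span_le]
    rintro _ ⟨i, rfl⟩
    exact h i
  · rw [(spanGr f).finrank_eq, W.finrank_eq]

theorem polyOfCoeffs_mem_spanGr (f : Frame r d) (i : Fin r) :
    polyOfCoeffs d (f.1 i) ∈ (spanGr f).carrier :=
  Submodule.subset_span ⟨i, rfl⟩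

theorem spanGr_surjective : Function.Surjective (spanGr (r := r) (d := d)) := by
  intro W
  have := W.finite
  let b := Module.finBasisOfFinrankEq ℂ W.carrier W.finrank_eq
  choose a ha using fun i => exists_polyOfCoeffs_eq (W.le_degreeLT (b i).2)
  have hli : LinearIndependent ℂ a := by
    refine LinearIndependent.of_comp (polyOfCoeffs d) ?_
    have h2 := b.linearIndependent.map' W.carrier.subtype (Submodule.ker_subtype _)
    convert! h2 using 1
    exact funext ha
  exact ⟨⟨a, hli⟩, spanGr_eq_of_mem _ _ fun i => by rw [ha]; exact (b i).2⟩

theorem polyOfCoeffs_mul (g : Matrix (Fin r) (Fin r) ℂ) (A : Fin r → Fin d → ℂ) (i : Fin r) :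
    polyOfCoeffs d ((g * Matrix.of A) i) = ∑ j, g i j • polyOfCoeffs d (A j) := by
  have : (g * Matrix.of A) i = ∑ j, g i j • A j := by
    ext k
    simp [Matrix.mul_apply]
  rw [this, map_sum]
  simp

/-- Every family of members of the span of a frame is obtained from the frame by a matrix. -/
theorem exists_mul_of_mem (B : Frame r d) (A : Fin r → Fin d → ℂ)
    (h : ∀ i, polyOfCoeffs d (A i) ∈ (spanGr B).carrier) :
    ∃ g : Matrix (Fin r) (Fin r) ℂ, Matrix.of A = g * Matrix.of B.1 := by
  have h1 := fun i => (Submodule.mem_span_range_iff_exists_fun ℂ).1 (h i)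
  choose g hg using h1
  refine ⟨Matrix.of g, Matrix.ext fun i k => ?_⟩
  refine congrFun (polyOfCoeffs_injective d ?_ : A i = (Matrix.of g * Matrix.of B.1) i) k
  rw [polyOfCoeffs_mul, ← hg i]
  rfl

theorem spanGr_eq_of_mul {A B : Frame r d} {g : Matrix (Fin r) (Fin r) ℂ}
    (h : Matrix.of A.1 = g * Matrix.of B.1) : spanGr A = spanGr B := by
  refine spanGr_eq_of_mem _ _ fun i => ?_
  have : A.1 i = (g * Matrix.of B.1) i := congrFun h i
  rw [this, polyOfCoeffs_mul]
  exact Submodule.sum_mem _ fun j _ => Submodule.smul_mem _ _ (polyOfCoeffs_mem_spanGr B j)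

theorem continuous_spanGr : Continuous (spanGr (r := r) (d := d)) := continuous_coinduced_rng

/-! ### Generalized Plücker coordinates -/

/-- The determinant of the `r × d` matrix `A` times a fixed `d × r` matrix `E`. It is multiplied by
`det g` when `A` is multiplied on the left by `g`; both the maximal minors of `A` and the values of
the Wronskian of the rows of `A` are of this form. -/
noncomputable def plucker (E : Matrix (Fin d) (Fin r) ℂ) (A : Fin r → Fin d → ℂ) : ℂ :=
  (Matrix.of A * E).det

theorem plucker_mul (E : Matrix (Fin d) (Fin r) ℂ) {A B : Fin r → Fin d → ℂ}
    {g : Matrix (Fin r) (Fin r) ℂ} (h : Matrix.of A = g * Matrix.of B) :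
    plucker E A = g.det * plucker E B := by
  rw [plucker, h, Matrix.mul_assoc, Matrix.det_mul, plucker]

theorem linearIndependent_of_plucker_ne_zero {E : Matrix (Fin d) (Fin r) ℂ}
    {A : Fin r → Fin d → ℂ} (h : plucker E A ≠ 0) : LinearIndependent ℂ A := by
  have h1 : IsUnit (Matrix.of A * E) := (Matrix.isUnit_iff_isUnit_det _).2 h.isUnit
  have h2 := Matrix.linearIndependent_rows_iff_isUnit.2 h1
  refine LinearIndependent.of_comp (Matrix.vecMulLinear E) ?_
  convert! h2 using 1

theorem continuous_plucker (E : Matrix (Fin d) (Fin r) ℂ) : Continuous (plucker E) := by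
  unfold plucker
  exact Continuous.matrix_det (Continuous.matrix_mul (by exact continuous_id) continuous_const)

/-- The maximal minor of `A` on the columns `c`. -/
noncomputable def minor (c : Fin r → Fin d) (A : Fin r → Fin d → ℂ) : ℂ :=
  ((Matrix.of A).submatrix id c).det

/-- The matrix whose multiplication on the right selects the columns `c`. -/
def colSelect (c : Fin r → Fin d) : Matrix (Fin d) (Fin r) ℂ :=
  Matrix.of fun k j => if k = c j then 1 else 0

theorem plucker_colSelect (c : Fin r → Fin d) (A : Fin r → Fin d → ℂ) :
    plucker (colSelect c) A = minor c A := by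
  rw [plucker, minor]
  congr 1
  ext i j
  simp [Matrix.mul_apply, colSelect]

theorem plucker_eq_sum_minor (E : Matrix (Fin d) (Fin r) ℂ) (A : Fin r → Fin d → ℂ) :
    plucker E A = ∑ c : Fin r → Fin d, (∏ j, E (c j) j) * minor c A := by
  have h1 : (Matrix.of A * E).transpose = fun j => ∑ k, E k j • fun i => A i k := by
    ext j i
    simp [Matrix.mul_apply, mul_comm]
  rw [plucker, ← Matrix.det_transpose, h1]
  have h2 := (Matrix.detRowAlternating (R := ℂ) (n := Fin r)).toMultilinearMap.map_sum
    (fun j k => E k j • fun i => A i k)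
  refine h2.trans (Finset.sum_congr rfl fun c _ => ?_)
  rw [MultilinearMap.map_smul_univ, smul_eq_mul]
  congr 1
  rw [minor, ← Matrix.det_transpose]
  rfl

theorem exists_minor_ne_zero {A : Fin r → Fin d → ℂ} (hA : LinearIndependent ℂ A) :
    ∃ c, minor c A ≠ 0 := by
  by_contra! hcon
  -- a right inverse of `A` gives `det (A * E) = 1`, a combination of the minors
  obtain ⟨E, hE⟩ : ∃ E : Matrix (Fin d) (Fin r) ℂ, Matrix.of A * E = 1 := by
    obtain ⟨g, hg⟩ := LinearMap.exists_leftInverse_of_injective (Matrix.vecMulLinear (Matrix.of A))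
      (LinearMap.ker_eq_bot.2 (Matrix.vecMul_injective_iff.2 hA))
    refine ⟨Matrix.of fun k => g (Pi.single k 1), ?_⟩
    ext i j
    have h1 := congrFun (LinearMap.congr_fun hg (Pi.single i 1)) j
    have h2 : Matrix.vecMulLinear (Matrix.of A) (Pi.single i 1) =
        ∑ k, A i k • Pi.single k (1 : ℂ) := by
      ext k
      simp [Pi.single_apply]
    rw [LinearMap.comp_apply, h2, map_sum] at h1
    simpa [Matrix.mul_apply, Matrix.one_apply, Pi.single_apply, eq_comm] using h1
  have h1 : plucker E A = 1 := by rw [plucker, hE, Matrix.det_one]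
  rw [plucker_eq_sum_minor] at h1
  simp [hcon] at h1

/-- Cramer's rule: after normalizing the columns `c` to the identity matrix, the entries of `A`
are ratios of maximal minors. -/
theorem inv_mul_apply_eq_minor_div {c : Fin r → Fin d} {A : Fin r → Fin d → ℂ}
    (hc : minor c A ≠ 0) (i : Fin r) (k : Fin d) :
    (((Matrix.of A).submatrix id c)⁻¹ * Matrix.of A) i k =
      minor (Function.update c i k) A / minor c A := by
  set B := (Matrix.of A).submatrix id c with hB
  have hdet : B.det ≠ 0 := hc
  have h1 : B.updateCol i (fun j => A j k) =
      (Matrix.of A).submatrix id (Function.update c i k) := by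
    ext a b
    by_cases h : b = i
    · subst h; simp
    · simp [h, hB]
  have h2 : (B⁻¹ * Matrix.of A) i k = (B⁻¹.mulVec fun j => A j k) i := rfl
  rw [h2, Matrix.inv_def, Matrix.smul_mulVec, ← Matrix.cramer_eq_adjugate_mulVec, Pi.smul_apply,
    Matrix.cramer_apply, h1, minor, minor, ← hB, Ring.inverse_eq_inv', smul_eq_mul, div_eq_inv_mul]

/-- The sum of the squared absolute values of the maximal minors. -/
noncomputable def minorNorm (A : Fin r → Fin d → ℂ) : ℝ := ∑ c : Fin r → Fin d, ‖minor c A‖ ^ 2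

theorem minorNorm_pos {A : Fin r → Fin d → ℂ} (hA : LinearIndependent ℂ A) : 0 < minorNorm A := by
  obtain ⟨c, hc⟩ := exists_minor_ne_zero hA
  exact Finset.sum_pos' (fun _ _ => by positivity) ⟨c, Finset.mem_univ c, by positivity⟩

theorem continuous_minorNorm : Continuous (minorNorm (r := r) (d := d)) := by
  unfold minorNorm
  simp_rw [← plucker_colSelect]
  exact continuous_finsetSum _ fun c _ => (continuous_plucker _).norm.pow 2

theorem minorNorm_mul {A B : Fin r → Fin d → ℂ} {g : Matrix (Fin r) (Fin r) ℂ}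
    (h : Matrix.of A = g * Matrix.of B) : minorNorm A = ‖g.det‖ ^ 2 * minorNorm B := by
  simp_rw [minorNorm, ← plucker_colSelect, plucker_mul _ h, norm_mul, mul_pow, Finset.mul_sum]

/-- The `GL_r`-invariant function of a frame `A` given by the products of two generalized Plücker
coordinates, one of them conjugated, normalized by `minorNorm`. It is defined through a chosen frame
of `W`; by `pairing_spanGr` the choice does not matter. -/
noncomputable def pairing (E E' : Matrix (Fin d) (Fin r) ℂ) (W : Gr r d) : ℂ :=
  plucker E (Function.surjInv spanGr_surjective W).1 *
    starRingEnd ℂ (plucker E' (Function.surjInv spanGr_surjective W).1) /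
      minorNorm (Function.surjInv spanGr_surjective W).1

theorem pairing_spanGr (E E' : Matrix (Fin d) (Fin r) ℂ) (A : Frame r d) :
    pairing E E' (spanGr A) =
      plucker E A.1 * starRingEnd ℂ (plucker E' A.1) / minorNorm A.1 := by
  set B := Function.surjInv spanGr_surjective (spanGr A) with hB
  have hBA : spanGr B = spanGr A := Function.surjInv_eq _ _
  obtain ⟨g, hg⟩ := exists_mul_of_mem B A.1 fun i => by
    rw [hBA]; exact polyOfCoeffs_mem_spanGr A i
  have hpos := minorNorm_pos A.2
  have hBpos := minorNorm_pos B.2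
  rw [minorNorm_mul hg] at hpos
  have hdet : g.det ≠ 0 := by
    intro h
    simp [h] at hpos
  rw [pairing, ← hB, plucker_mul E hg, plucker_mul E' hg, minorNorm_mul hg, map_mul]
  have h2 : ((‖g.det‖ ^ 2 * minorNorm B.1 : ℝ) : ℂ) =
      g.det * starRingEnd ℂ g.det * minorNorm B.1 := by
    rw [Complex.mul_conj, Complex.normSq_eq_norm_sq]
    push_cast
    rfl
  have h3 : starRingEnd ℂ g.det ≠ 0 := (_root_.map_ne_zero _).2 hdet
  have h4 : (minorNorm B.1 : ℂ) ≠ 0 := Complex.ofReal_ne_zero.2 hBpos.ne'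
  rw [h2]
  field_simp

theorem continuous_pairing (E E' : Matrix (Fin d) (Fin r) ℂ) : Continuous (pairing E E') := by
  refine continuous_coinduced_dom.2 ?_
  have : pairing E E' ∘ spanGr = fun A : Frame r d =>
      plucker E A.1 * starRingEnd ℂ (plucker E' A.1) / minorNorm A.1 :=
    funext fun A => pairing_spanGr E E' A
  rw [this]
  refine Continuous.div ?_ ?_ fun A => Complex.ofReal_ne_zero.2 (minorNorm_pos A.2).ne'
  · exact ((continuous_plucker E).comp continuous_subtype_val).mul
      (Complex.continuous_conj.comp ((continuous_plucker E').comp continuous_subtype_val))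
  · exact Complex.continuous_ofReal.comp (continuous_minorNorm.comp continuous_subtype_val)

/-- Frames with proportional maximal minors span the same subspace. -/
theorem spanGr_eq_of_minor_eq {A B : Frame r d} {κ : ℂ}
    (h : ∀ c, minor c A.1 = κ * minor c B.1) : spanGr A = spanGr B := by
  obtain ⟨c, hc⟩ := exists_minor_ne_zero A.2
  have hκ : κ ≠ 0 := fun h0 => hc (by rw [h, h0, zero_mul])
  have hcB : minor c B.1 ≠ 0 := fun h0 => hc (by rw [h, h0, mul_zero])
  have h1 : ((Matrix.of A.1).submatrix id c)⁻¹ * Matrix.of A.1 =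
      ((Matrix.of B.1).submatrix id c)⁻¹ * Matrix.of B.1 := by
    ext i k
    rw [inv_mul_apply_eq_minor_div hc, inv_mul_apply_eq_minor_div hcB, h, h, mul_div_mul_left _ _ hκ]
  refine spanGr_eq_of_mul
    (g := (Matrix.of A.1).submatrix id c * ((Matrix.of B.1).submatrix id c)⁻¹) ?_
  rw [Matrix.mul_assoc, ← h1, Matrix.mul_nonsing_inv_cancel_left _ _ (Ne.isUnit hc)]

instance : T2Space (Gr r d) := by
  refine T2Space.of_injective_continuous
    (f := fun W (p : (Fin r → Fin d) × (Fin r → Fin d)) =>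
      pairing (colSelect p.1) (colSelect p.2) W) ?_
    (continuous_pi fun p => continuous_pairing _ _)
  intro W W' h
  obtain ⟨A, rfl⟩ := spanGr_surjective W
  obtain ⟨B, rfl⟩ := spanGr_surjective W'
  obtain ⟨c, hc⟩ := exists_minor_ne_zero A.2
  have hA := minorNorm_pos A.2
  have hB := minorNorm_pos B.2
  have h1 : ∀ c', minor c' A.1 * starRingEnd ℂ (minor c A.1) / minorNorm A.1 =
      minor c' B.1 * starRingEnd ℂ (minor c B.1) / minorNorm B.1 := by
    intro c'
    have := congrFun h (c', c)
    simpa only [pairing_spanGr, plucker_colSelect] using this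
  have h2 : starRingEnd ℂ (minor c A.1) ≠ 0 := (_root_.map_ne_zero _).2 hc
  refine spanGr_eq_of_minor_eq (κ := (minorNorm A.1 / starRingEnd ℂ (minor c A.1)) *
    (starRingEnd ℂ (minor c B.1) / minorNorm B.1)) fun c' => ?_
  have h3 := h1 c'
  have h4 : (minorNorm A.1 : ℂ) ≠ 0 := Complex.ofReal_ne_zero.2 hA.ne'
  have h5 : (minorNorm B.1 : ℂ) ≠ 0 := Complex.ofReal_ne_zero.2 hB.ne'
  field_simp at h3 ⊢
  linear_combination h3

/-- Normalizing a maximal minor of largest absolute value to the identity matrix gives a frame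
with entries in the closed unit disc; so the Grassmannian is a finite union of compact sets. -/
instance : CompactSpace (Gr r d) := by
  let K : (Fin r → Fin d) → Set (Fin r → Fin d → ℂ) := fun c =>
    {A | (Matrix.of A).submatrix id c = 1} ∩ Metric.closedBall 0 1
  have hK : ∀ c, IsCompact (K c) := fun c => by
    refine (isCompact_closedBall _ _).inter_left (isClosed_eq ?_ continuous_const)
    exact Continuous.matrix_submatrix (by exact continuous_id) _ _
  have hKi : ∀ c, ∀ A ∈ K c, LinearIndependent ℂ A := fun c A hA => by
    refine linearIndependent_of_plucker_ne_zero (E := colSelect c) ?_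
    rw [plucker_colSelect, minor, show (Matrix.of A).submatrix id c = 1 from hA.1, Matrix.det_one]
    exact one_ne_zero
  have hK' : ∀ c, IsCompact ((↑) ⁻¹' K c : Set (Frame r d)) := fun c => by
    have h : K c ⊆ Set.range (Subtype.val : Frame r d → Fin r → Fin d → ℂ) :=
      fun A hA => ⟨⟨A, hKi c A hA⟩, rfl⟩
    rw [Topology.IsEmbedding.subtypeVal.isCompact_iff, Set.image_preimage_eq_inter_range,
      Set.inter_eq_left.2 h]
    exact hK c
  refine ⟨?_⟩
  have : (Set.univ : Set (Gr r d)) = ⋃ c, spanGr '' ((↑) ⁻¹' K c : Set (Frame r d)) := by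
    refine (Set.eq_univ_of_forall fun W => ?_).symm
    obtain ⟨A, rfl⟩ := spanGr_surjective W
    obtain ⟨c₀, hc₀⟩ := exists_minor_ne_zero A.2
    obtain ⟨c, -, hmax⟩ := Finset.exists_max_image Finset.univ (fun c => ‖minor c A.1‖)
      ⟨c₀, Finset.mem_univ _⟩
    have hc : minor c A.1 ≠ 0 := norm_pos_iff.1
      ((norm_pos_iff.2 hc₀).trans_le (hmax c₀ (Finset.mem_univ _)))
    set B : Fin r → Fin d → ℂ := ((Matrix.of A.1).submatrix id c)⁻¹ * Matrix.of A.1 with hB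
    have hBA : Matrix.of B = ((Matrix.of A.1).submatrix id c)⁻¹ * Matrix.of A.1 := rfl
    have hBK : B ∈ K c := by
      constructor
      · have : (Matrix.of B).submatrix id c = ((Matrix.of A.1).submatrix id c)⁻¹ *
            (Matrix.of A.1).submatrix id c := rfl
        exact this.trans (Matrix.nonsing_inv_mul _ (Ne.isUnit hc))
      · rw [mem_closedBall_zero_iff, pi_norm_le_iff_of_nonneg zero_le_one]
        intro i
        rw [pi_norm_le_iff_of_nonneg zero_le_one]
        intro k
        rw [hB, inv_mul_apply_eq_minor_div hc, norm_div]
        exact div_le_one_of_le₀ (hmax _ (Finset.mem_univ _)) (norm_nonneg _)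
    exact Set.mem_iUnion.2 ⟨c, ⟨B, hKi c B hBK⟩, hBK, spanGr_eq_of_mul hBA⟩
  rw [this]
  exact isCompact_iUnion fun c => (hK' c).image continuous_spanGr

/-! ### The degree of a Wronskian -/

/-- The Wronskian determinant of a family of polynomials. -/
noncomputable def wronskiDet {r : ℕ} (f : Fin r → ℂ[X]) : ℂ[X] :=
  (Matrix.of fun i j : Fin r => derivative^[(j : ℕ)] (f i)).det

theorem natDegree_prod_le_and_coeff {ι : Type*} (s : Finset ι) (f : ι → ℂ[X]) (n : ι → ℕ)
    (h : ∀ i ∈ s, (f i).natDegree ≤ n i) :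
    (∏ i ∈ s, f i).natDegree ≤ ∑ i ∈ s, n i ∧
      (∏ i ∈ s, f i).coeff (∑ i ∈ s, n i) = ∏ i ∈ s, (f i).coeff (n i) := by
  classical
  induction s using Finset.induction_on with
  | empty => simp
  | insert a s ha ih =>
    obtain ⟨ih1, ih2⟩ := ih fun i hi => h i (Finset.mem_insert_of_mem hi)
    have h1 := h a (Finset.mem_insert_self a s)
    rw [Finset.prod_insert ha, Finset.prod_insert ha, Finset.sum_insert ha]
    exact ⟨natDegree_mul_le_of_le h1 ih1, by rw [coeff_mul_add_eq_of_natDegree_le h1 ih1, ih2]⟩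

/-- Bound on the degree of a determinant whose rows have bounded degree, with the coefficient at
the bound. -/
theorem natDegree_det_le_and_coeff {r : ℕ} (M : Matrix (Fin r) (Fin r) ℂ[X]) (e : Fin r → ℕ)
    (h : ∀ i j, (M i j).natDegree ≤ e i) :
    M.det.natDegree ≤ ∑ i, e i ∧
      M.det.coeff (∑ i, e i) = (Matrix.of fun i j => (M i j).coeff (e i)).det := by
  have key := fun σ : Equiv.Perm (Fin r) =>
    natDegree_prod_le_and_coeff Finset.univ (fun i => M (σ i) i) (fun i => e (σ i))
      fun i _ => h _ _
  simp_rw [Equiv.sum_comp _ e] at key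
  rw [Matrix.det_apply, Matrix.det_apply]
  constructor
  · refine natDegree_sum_le_of_forall_le _ _ fun σ _ => ?_
    rw [Units.smul_def]
    exact (natDegree_smul_le _ _).trans (key σ).1
  · rw [finsetSum_coeff]
    refine Finset.sum_congr rfl fun σ _ => ?_
    rw [Units.smul_def, Units.smul_def, coeff_smul, (key σ).2]
    rfl

theorem natDegree_X_pow_mul_iterate_derivative_le (f : ℂ[X]) (j : ℕ) :
    (X ^ j * derivative^[j] f).natDegree ≤ f.natDegree := by
  refine natDegree_le_iff_coeff_eq_zero.2 fun N hN => ?_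
  rw [coeff_X_pow_mul']
  split_ifs with h
  · rw [coeff_iterate_derivative, Nat.sub_add_cancel h, coeff_eq_zero_of_natDegree_lt hN, smul_zero]
  · rfl

theorem coeff_X_pow_mul_iterate_derivative (f : ℂ[X]) (j k : ℕ) :
    (X ^ j * derivative^[j] f).coeff k = (k.descFactorial j : ℂ) * f.coeff k := by
  rw [coeff_X_pow_mul']
  split_ifs with h
  · rw [coeff_iterate_derivative, Nat.sub_add_cancel h, nsmul_eq_mul]
  · rw [Nat.descFactorial_eq_zero_iff_lt.2 (not_le.1 h), Nat.cast_zero, zero_mul]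

theorem det_descFactorial_ne_zero {r : ℕ} {e : Fin r → ℕ} (he : Function.Injective e) :
    (Matrix.of fun i j : Fin r => ((e i).descFactorial (j : ℕ) : ℂ)).det ≠ 0 := by
  have h1 := Matrix.det_eval_matrixOfPolynomials_eq_det_vandermonde (fun i => (e i : ℂ))
    (fun j : Fin r => descPochhammer ℂ j) (fun j => descPochhammer_natDegree ℂ j)
    (fun j => monic_descPochhammer ℂ j)
  simp only [descPochhammer_eval_eq_descFactorial] at h1
  rw [← h1, Matrix.det_vandermonde_ne_zero_iff]
  exact Nat.cast_injective.comp he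

/-- The Wronskian of polynomials of distinct degrees `e i` is nonzero of degree
`∑ e i - r (r - 1) / 2`. Multiplying the `j`-th derivative by `u ^ j` gives an operator that is
diagonal on monomials, so the top coefficient is a Vandermonde determinant in the `e i`. -/
theorem wronskiDet_ne_zero_and_natDegree {r : ℕ} {f : Fin r → ℂ[X]} (hf : ∀ i, f i ≠ 0)
    (he : Function.Injective fun i => (f i).natDegree) :
    wronskiDet f ≠ 0 ∧ (wronskiDet f).natDegree + ∑ i : Fin r, (i : ℕ) = ∑ i, (f i).natDegree := by
  set M : Matrix (Fin r) (Fin r) ℂ[X] :=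
    Matrix.of fun i j => X ^ (j : ℕ) * derivative^[(j : ℕ)] (f i) with hM
  have h1 : M.det = (∏ j : Fin r, X ^ (j : ℕ)) * wronskiDet f :=
    Matrix.det_mul_row (fun j : Fin r => (X : ℂ[X]) ^ (j : ℕ))
      (Matrix.of fun i j : Fin r => derivative^[(j : ℕ)] (f i))
  obtain ⟨h2, h3⟩ := natDegree_det_le_and_coeff M (fun i => (f i).natDegree)
    fun i j => natDegree_X_pow_mul_iterate_derivative_le _ _
  have h4 : (Matrix.of fun i j => (M i j).coeff (f i).natDegree).det =
      (∏ i, (f i).leadingCoeff) *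
        (Matrix.of fun i j : Fin r => ((f i).natDegree.descFactorial (j : ℕ) : ℂ)).det := by
    rw [← Matrix.det_mul_column]
    congr 1
    ext i j
    simp only [hM, Matrix.of_apply, coeff_X_pow_mul_iterate_derivative, leadingCoeff]
    ring
  have h5 : M.det.coeff (∑ i, (f i).natDegree) ≠ 0 := by
    rw [h3, h4]
    exact mul_ne_zero (Finset.prod_ne_zero_iff.2 fun i _ => leadingCoeff_ne_zero.2 (hf i))
      (det_descFactorial_ne_zero he)
  have h6 : M.det ≠ 0 := fun h => h5 (by rw [h, coeff_zero])
  have h7 : wronskiDet f ≠ 0 := fun h => h6 (by rw [h1, h, mul_zero])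
  refine ⟨h7, ?_⟩
  have h8 : M.det.natDegree = ∑ i, (f i).natDegree := le_antisymm h2 (le_natDegree_of_ne_zero h5)
  rw [← h8, h1, Finset.prod_pow_eq_pow_sum, natDegree_mul (pow_ne_zero _ X_ne_zero) h7,
    natDegree_X_pow, add_comm]

/-! ### The degrees of the members of a subspace -/

/-- The jump of `dim (W ∩ ℂ_{<k}[u])` at `k`. -/
theorem finrank_inf_degreeLT_succ (W : Gr r d) (k : ℕ) (p : Prop) [Decidable p]
    (hp : p ↔ ∃ f ∈ W.carrier, f ≠ 0 ∧ f.natDegree = k) :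
    Module.finrank ℂ (W.carrier ⊓ degreeLT ℂ (k + 1) : Submodule ℂ ℂ[X]) =
      Module.finrank ℂ (W.carrier ⊓ degreeLT ℂ k : Submodule ℂ ℂ[X]) + if p then 1 else 0 := by
  have := W.finite
  set V : Submodule ℂ ℂ[X] := W.carrier ⊓ degreeLT ℂ (k + 1) with hV
  have : FiniteDimensional ℂ V := Submodule.finiteDimensional_of_le inf_le_left
  -- the coefficient of degree `k`, whose kernel is the previous intersection
  let L : V →ₗ[ℂ] ℂ := lcoeff ℂ k ∘ₗ V.subtype
  have hL : ∀ x : V, L x = (x : ℂ[X]).coeff k := fun _ => rfl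
  have hdeg : ∀ f : ℂ[X], f ∈ degreeLT ℂ (k + 1) → (f.coeff k = 0 ↔ f ∈ degreeLT ℂ k) := by
    intro f hf
    rw [mem_degreeLT, degree_lt_iff_coeff_zero] at hf ⊢
    refine ⟨fun h m hm => ?_, fun h => h k le_rfl⟩
    rcases hm.eq_or_lt with rfl | hm
    · exact h
    · exact hf m hm
  have hker : (LinearMap.ker L).map V.subtype = W.carrier ⊓ degreeLT ℂ k := by
    ext f
    simp only [Submodule.mem_map, LinearMap.mem_ker, hL, Submodule.subtype_apply,
      Submodule.mem_inf]
    constructor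
    · rintro ⟨x, hx, rfl⟩
      exact ⟨x.2.1, (hdeg _ x.2.2).1 hx⟩
    · rintro ⟨h1, h2⟩
      have h3 : f ∈ degreeLT ℂ (k + 1) := degreeLT_mono k.le_succ h2
      exact ⟨⟨f, h1, h3⟩, (hdeg _ h3).2 h2, rfl⟩
  rw [← LinearMap.finrank_range_add_finrank_ker L, ← hker, Submodule.finrank_map_subtype_eq,
    add_comm]
  congr 1
  split_ifs with h
  · obtain ⟨f, hfW, hf0, rfl⟩ := hp.1 h
    have hfV : f ∈ V := ⟨hfW, mem_degreeLT.2 (by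
      rw [degree_eq_natDegree hf0]; exact_mod_cast f.natDegree.lt_succ_self)⟩
    have hne : L ≠ 0 := fun h0 => leadingCoeff_ne_zero.2 hf0 (LinearMap.congr_fun h0 ⟨f, hfV⟩)
    rw [LinearMap.range_eq_top.2 (LinearMap.surjective hne), finrank_top, Module.finrank_self]
  · have hzero : L = 0 := by
      ext x
      by_contra hx
      refine h (hp.2 ⟨x, x.2.1, ?_, ?_⟩)
      · rintro h0
        exact hx (by rw [hL, h0]; rfl)
      · have h1 : (x : ℂ[X]) ∈ degreeLT ℂ (k + 1) := x.2.2
        rw [mem_degreeLT, degree_lt_iff_coeff_zero] at h1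
        exact le_antisymm (natDegree_le_iff_coeff_eq_zero.2 fun N hN => h1 N hN)
          (le_natDegree_of_ne_zero hx)
    rw [hzero, LinearMap.range_zero, finrank_bot]

/-- Every `W` has a basis of polynomials of distinct degrees `e i`, and these degrees determine the
dimensions of the intersections of `W` with the members of the flag at infinity. -/
theorem exists_degree_sequence (W : Gr r d) : ∃ e : Fin r → ℕ, StrictMono e ∧ (∀ i, e i < d) ∧
    (∀ k, Module.finrank ℂ (W.carrier ⊓ degreeLT ℂ k : Submodule ℂ ℂ[X]) =
      (Finset.univ.filter fun i => e i < k).card) ∧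
    ∃ f : Fin r → ℂ[X], ∀ i, f i ∈ W.carrier ∧ f i ≠ 0 ∧ (f i).natDegree = e i := by
  classical
  let P : ℕ → Prop := fun k => ∃ f ∈ W.carrier, f ≠ 0 ∧ f.natDegree = k
  have hPd : ∀ k, P k → k < d := by
    rintro _ ⟨f, hf, hf0, rfl⟩
    have := mem_degreeLT.1 (W.le_degreeLT hf)
    rw [degree_eq_natDegree hf0] at this
    exact_mod_cast this
  have hcount : ∀ k, Module.finrank ℂ (W.carrier ⊓ degreeLT ℂ k : Submodule ℂ ℂ[X]) =
      ((Finset.range k).filter P).card := by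
    intro k
    induction k with
    | zero =>
      have : degreeLT ℂ 0 = ⊥ := by
        rw [eq_bot_iff]
        intro f hf
        rw [mem_degreeLT, degree_lt_iff_coeff_zero] at hf
        exact (Submodule.mem_bot ℂ).2 (Polynomial.ext fun m => hf m (Nat.zero_le m))
      simp [this]
    | succ k ih =>
      rw [finrank_inf_degreeLT_succ W k (P k) Iff.rfl, ih, Finset.range_add_one,
        Finset.filter_insert]
      split_ifs with h
      · rw [Finset.card_insert_of_notMem (by simp)]
      · rfl
  have hcard : ((Finset.range d).filter P).card = r := by
    rw [← hcount, inf_eq_left.2 W.le_degreeLT, W.finrank_eq]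
  let e := ((Finset.range d).filter P).orderEmbOfFin hcard
  have he : ∀ i, e i ∈ (Finset.range d).filter P := fun i => Finset.orderEmbOfFin_mem _ _ _
  refine ⟨e, e.strictMono, fun i => Finset.mem_range.1 (Finset.mem_filter.1 (he i)).1, ?_, ?_⟩
  · intro k
    rw [hcount, ← Finset.card_map e.toEmbedding]
    congr 1
    ext m
    simp only [Finset.mem_filter, Finset.mem_range, Finset.mem_map, Finset.mem_univ, true_and,
      RelEmbedding.coe_toEmbedding]
    constructor
    · rintro ⟨hm, hP⟩
      have : m ∈ Set.range e := by
        rw [Finset.range_orderEmbOfFin]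
        exact Finset.mem_coe.2 (Finset.mem_filter.2 ⟨Finset.mem_range.2 (hPd m hP), hP⟩)
      obtain ⟨i, rfl⟩ := this
      exact ⟨i, hm, rfl⟩
    · rintro ⟨i, hi, rfl⟩
      exact ⟨hi, (Finset.mem_filter.1 (he i)).2⟩
  · choose f hf using fun i => (Finset.mem_filter.1 (he i)).2
    exact ⟨f, hf⟩

/-! ### The Wronskian of a frame -/

/-- The matrix of the values at `c` of the first `r` derivatives of the monomials. -/
noncomputable def jetMatrix (r d : ℕ) (c : ℂ) : Matrix (Fin d) (Fin r) ℂ :=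
  Matrix.of fun k j => (derivative^[(j : ℕ)] (X ^ (k : ℕ) : ℂ[X])).eval c

theorem of_mul_jetMatrix (A : Fin r → Fin d → ℂ) (c : ℂ) (i j : Fin r) :
    (Matrix.of A * jetMatrix r d c) i j =
      (derivative^[(j : ℕ)] (polyOfCoeffs d (A i))).eval c := by
  rw [polyOfCoeffs_apply, iterate_derivative_sum, eval_finsetSum, Matrix.mul_apply]
  refine Finset.sum_congr rfl fun k _ => ?_
  rw [← C_mul_X_pow_eq_monomial, iterate_derivative_C_mul, eval_mul, eval_C]
  rfl

/-- The values of the Wronskian of a frame are generalized Plücker coordinates. -/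
theorem eval_wronskiDet (A : Fin r → Fin d → ℂ) (c : ℂ) :
    (wronskiDet fun i => polyOfCoeffs d (A i)).eval c = plucker (jetMatrix r d c) A := by
  rw [wronskiDet, plucker, ← coe_evalRingHom, RingHom.map_det]
  congr 1
  ext i j
  rw [of_mul_jetMatrix]
  rfl

/-- The Wronskian of any frame of `W` is nonzero, and its degree is given by the degrees of the
members of `W`. -/
theorem wronskiDet_frame (A : Frame r d) {f : Fin r → ℂ[X]}
    (hf : ∀ i, f i ∈ (spanGr A).carrier ∧ f i ≠ 0)
    (hinj : Function.Injective fun i => (f i).natDegree) :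
    (wronskiDet fun i => polyOfCoeffs d (A.1 i)) ≠ 0 ∧
      (wronskiDet fun i => polyOfCoeffs d (A.1 i)).natDegree + ∑ i : Fin r, (i : ℕ) =
        ∑ i, (f i).natDegree := by
  obtain ⟨h1, h2⟩ := wronskiDet_ne_zero_and_natDegree (fun i => (hf i).2) hinj
  choose b hb using fun i => exists_polyOfCoeffs_eq ((spanGr A).le_degreeLT (hf i).1)
  obtain ⟨g, hg⟩ := exists_mul_of_mem A b fun i => by rw [hb]; exact (hf i).1
  have h3 : wronskiDet f = C g.det * wronskiDet fun i => polyOfCoeffs d (A.1 i) := by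
    refine Polynomial.funext fun c => ?_
    rw [eval_mul, eval_C, eval_wronskiDet, ← plucker_mul _ hg, ← eval_wronskiDet]
    simp_rw [hb]
  have h4 : g.det ≠ 0 := fun h => h1 (by rw [h3, h, C_0, zero_mul])
  have h5 : (wronskiDet fun i => polyOfCoeffs d (A.1 i)) ≠ 0 := fun h =>
    h1 (by rw [h3, h, mul_zero])
  refine ⟨h5, ?_⟩
  rw [← h2, h3, natDegree_C_mul h4]

/-! ### Semicontinuity of intersection dimensions -/

/-- The matrix of a frame, transposed, with the coefficients of degree less than `k` removed. -/
def highPart (k : ℕ) (A : Fin r → Fin d → ℂ) : Matrix (Fin d) (Fin r) ℂ :=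
  Matrix.of fun j i => if (j : ℕ) < k then 0 else A i j

/-- The kernel of `highPart k A` consists of the linear combinations of the frame that have degree
less than `k`. -/
theorem finrank_inf_degreeLT_add_rank (A : Frame r d) (k : ℕ) :
    Module.finrank ℂ ((spanGr A).carrier ⊓ degreeLT ℂ k : Submodule ℂ ℂ[X]) +
      Module.finrank ℂ (LinearMap.range (Matrix.toLin' (highPart k A.1))) = r := by
  set Φ := Fintype.linearCombination ℂ (fun i => polyOfCoeffs d (A.1 i)) with hΦ
  have hinj : Function.Injective Φ := (A.2.map' (polyOfCoeffs d)
    (LinearMap.ker_eq_bot.2 (polyOfCoeffs_injective d))).fintypeLinearCombination_injective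
  have hrange : LinearMap.range Φ = (spanGr A).carrier := Fintype.range_linearCombination ℂ _
  have hcoeff : ∀ (a : Fin r → ℂ) (m : ℕ) (hm : m < d), (Φ a).coeff m = ∑ i, a i * A.1 i ⟨m, hm⟩ := by
    intro a m hm
    rw [hΦ, Fintype.linearCombination_apply, finsetSum_coeff]
    refine Finset.sum_congr rfl fun i _ => ?_
    rw [coeff_smul, smul_eq_mul, polyOfCoeffs_apply, finsetSum_coeff]
    simp_rw [coeff_monomial]
    rw [Finset.sum_eq_single (⟨m, hm⟩ : Fin d)]
    · simp
    · intro j _ hj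
      rw [if_neg fun h => hj (Fin.ext h)]
    · simp
  have hmap : (LinearMap.ker (Matrix.toLin' (highPart k A.1))).map Φ =
      (spanGr A).carrier ⊓ degreeLT ℂ k := by
    have hmem : ∀ a, a ∈ LinearMap.ker (Matrix.toLin' (highPart k A.1)) ↔
        Φ a ∈ degreeLT ℂ k := by
      intro a
      have hd : Φ a ∈ degreeLT ℂ d := (spanGr A).le_degreeLT (hrange ▸ LinearMap.mem_range_self Φ a)
      rw [mem_degreeLT, degree_lt_iff_coeff_zero] at hd ⊢
      rw [LinearMap.mem_ker, Matrix.toLin'_apply, funext_iff]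
      have hentry : ∀ j : Fin d, (highPart k A.1).mulVec a j =
          if (j : ℕ) < k then 0 else (Φ a).coeff j := by
        intro j
        rw [hcoeff a j j.2]
        simp only [Matrix.mulVec, dotProduct, highPart, Matrix.of_apply]
        split_ifs with h
        · simp
        · exact Finset.sum_congr rfl fun i _ => mul_comm _ _
      simp_rw [hentry]
      constructor
      · intro h m hm
        by_cases hmd : m < d
        · simpa [hm.not_gt] using h ⟨m, hmd⟩
        · exact hd m (not_lt.1 hmd)
      · intro h j
        rw [Pi.zero_apply, ite_eq_left_iff]
        exact fun hj => h j (not_lt.1 hj)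
    ext f
    rw [Submodule.mem_map, Submodule.mem_inf, ← hrange]
    constructor
    · rintro ⟨a, ha, rfl⟩
      exact ⟨⟨a, rfl⟩, (hmem a).1 ha⟩
    · rintro ⟨⟨a, rfl⟩, ha⟩
      exact ⟨a, (hmem a).2 ha, rfl⟩
  rw [← hmap, ← (Submodule.equivMapOfInjective Φ hinj _).finrank_eq, add_comm,
    LinearMap.finrank_range_add_finrank_ker, Module.finrank_fin_fun]

/-- The dimension of the intersection with a member of the flag at infinity is upper
semicontinuous. -/
theorem isClosed_le_finrank_inf_degreeLT (k m : ℕ) : IsClosed {W : Gr r d |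
    m ≤ Module.finrank ℂ (W.carrier ⊓ degreeLT ℂ k : Submodule ℂ ℂ[X])} := by
  rw [← isOpen_compl_iff]
  refine isOpen_coinduced.2 ?_
  let T : Matrix (Fin d) (Fin r) ℂ →ₗ[ℂ] ((Fin r → ℂ) →L[ℂ] (Fin d → ℂ)) :=
    LinearMap.toContinuousLinearMap.toLinearMap ∘ₗ Matrix.toLin'.toLinearMap
  have hT : Continuous fun A : Frame r d => T (highPart k A.1) := by
    refine T.continuous_of_finiteDimensional.comp
      (?_ : Continuous fun A : Frame r d => highPart k A.1)
    refine continuous_pi fun j => continuous_pi fun i => ?_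
    simp only [highPart, Matrix.of_apply]
    split_ifs
    · exact continuous_const
    · exact (continuous_apply j).comp ((continuous_apply i).comp continuous_subtype_val)
  convert! (isOpen_setOfPred_nat_le_rank (𝕜 := ℂ) (E := Fin r → ℂ)
    (F := Fin d → ℂ) (r + 1 - m)).preimage hT using 1
  ext A
  have h1 := finrank_inf_degreeLT_add_rank A k
  change ¬ (m ≤ _) ↔ ((r + 1 - m : ℕ) : Cardinal) ≤ (Matrix.toLin' (highPart k A.1)).rank
  rw [LinearMap.rank, ← Module.finrank_eq_rank, Nat.cast_le]
  omega

/-! ### Partitions and degree sequences -/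

theorem rowLen_le_of_fitsIn {c : ℕ} {lam : YoungDiagram} (h : FitsIn r c lam) (i : ℕ) :
    lam.rowLen i ≤ c := by
  by_contra! hlt
  exact lt_irrefl _ (h _ (YoungDiagram.mem_iff_lt_rowLen.2 hlt)).2

theorem card_eq_sum_rowLen {c : ℕ} {lam : YoungDiagram} (h : FitsIn r c lam) :
    lam.card = ∑ i ∈ Finset.range r, lam.rowLen i := by
  rw [YoungDiagram.card, Finset.card_eq_sum_card_fiberwise (f := Prod.fst) (t := Finset.range r)]
  · refine Finset.sum_congr rfl fun i _ => ?_
    rw [YoungDiagram.rowLen_eq_card]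
    rfl
  · intro x hx
    exact Finset.mem_coe.2 (Finset.mem_range.2 (h x ((YoungDiagram.mem_cells x).1 hx)).1)

theorem rowLen_compl {c : ℕ} {lam : YoungDiagram} {s : ℕ} (hs : s < r) :
    (compl r c lam).rowLen s = c - lam.rowLen (r - 1 - s) := by
  refine eq_of_forall_lt_iff fun j => ?_
  rw [← YoungDiagram.mem_iff_lt_rowLen]
  have : (s, j) ∈ compl r c lam ↔ (s < r ∧ j < c) ∧ (r - 1 - s, c - 1 - j) ∉ lam := by
    simp [compl, ← YoungDiagram.mem_cells]
  rw [this, YoungDiagram.mem_iff_lt_rowLen]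
  omega

/-- The increasing sequence of the degrees of the members of the subspaces in the Schubert cell of
the complement of `lam` at infinity. -/
def degreeSeq (r : ℕ) (lam : YoungDiagram) (i : Fin r) : ℕ := lam.rowLen (r - 1 - i) + i

theorem degreeSeq_strictMono (lam : YoungDiagram) : StrictMono (degreeSeq r lam) := by
  intro i j hij
  have h1 := lam.rowLen_anti (r - 1 - j) (r - 1 - i) (by omega)
  have h2 : (i : ℕ) < j := hij
  simp only [degreeSeq]
  omega

theorem sum_degreeSeq {c : ℕ} {lam : YoungDiagram} (h : FitsIn r c lam) :
    ∑ i, degreeSeq r lam i = lam.card + ∑ i : Fin r, (i : ℕ) := by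
  simp only [degreeSeq]
  rw [Finset.sum_add_distrib, card_eq_sum_rowLen h, ← Finset.sum_range_reflect,
    Finset.sum_range]

/-- The number of rows counted in the definition of the Schubert cell of the complement of `lam`. -/
theorem card_schubert_condition {lam : YoungDiagram} (h : FitsIn r (d - r) lam) (k : ℕ) :
    ((Finset.range r).filter fun s =>
      d - r + (s + 1) - (compl r (d - r) lam).rowLen s ≤ k).card =
      (Finset.univ.filter fun i => degreeSeq r lam i < k).card := by
  rw [Finset.card_filter, Finset.sum_range, Finset.card_filter]
  refine Finset.sum_congr rfl fun i _ => if_congr ?_ rfl rfl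
  rw [rowLen_compl i.2, degreeSeq]
  have := rowLen_le_of_fitsIn h (r - 1 - i)
  omega

/-- For strictly increasing `e`, the function `i ↦ e i - i` is monotone. -/
theorem add_le_add_of_strictMono {e : Fin r → ℕ} (he : StrictMono e) {i j : Fin r} (hij : i ≤ j) :
    e i + j ≤ e j + i := by
  obtain ⟨j, hj⟩ := j
  have h1 : (i : ℕ) ≤ j := hij
  induction j, h1 using Nat.le_induction with
  | base => exact le_rfl
  | succ j hij' ih =>
    have h2 := ih (Nat.lt_of_succ_lt hj) hij'
    have h3 : e ⟨j, Nat.lt_of_succ_lt hj⟩ < e ⟨j + 1, hj⟩ := he (Nat.lt_succ_self j)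
    simp only at h2 ⊢
    omega

/-- Every increasing sequence in `{0, …, d - 1}` is the degree sequence of a partition. -/
theorem exists_degreeSeq_eq {e : Fin r → ℕ} (he : StrictMono e) (hd : ∀ i, e i < d) :
    ∃ lam : YoungDiagram, FitsIn r (d - r) lam ∧ degreeSeq r lam = e := by
  classical
  let lam : YoungDiagram :=
    { cells := (Finset.range r ×ˢ Finset.range d).filter
        fun x => ∃ i : Fin r, x.1 + i + 1 = r ∧ x.2 + i < e i
      isLowerSet := by
        rintro ⟨a, b⟩ ⟨a', b'⟩ hle h
        obtain ⟨ha, hb⟩ : a' ≤ a ∧ b' ≤ b := hle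
        simp only [Finset.coe_filter, Finset.mem_product, Finset.mem_range,
          Set.mem_ofPred_eq] at h ⊢
        obtain ⟨⟨h1, h2⟩, i, h3, h4⟩ := h
        refine ⟨⟨by omega, by omega⟩, ⟨r - 1 - a', by omega⟩, by simp only; omega, ?_⟩
        have h5 := add_le_add_of_strictMono he (i := i) (j := ⟨r - 1 - a', by omega⟩)
          (Fin.mk_le_mk.2 (by omega) : (⟨i, i.2⟩ : Fin r) ≤ _)
        simp only at h5 ⊢
        omega }
  have hmem : ∀ a b, (a, b) ∈ lam ↔ (a < r ∧ b < d) ∧ ∃ i : Fin r, a + i + 1 = r ∧ b + i < e i := by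
    intro a b
    rw [← YoungDiagram.mem_cells]
    simp [lam]
  refine ⟨lam, ?_, ?_⟩
  · rintro ⟨a, b⟩ hx
    obtain ⟨⟨h1, -⟩, i, h2, h3⟩ := (hmem a b).1 hx
    have h4 := add_le_add_of_strictMono he (i := i) (j := ⟨r - 1, by omega⟩)
      (Fin.mk_le_mk.2 (by omega) : (⟨i, i.2⟩ : Fin r) ≤ _)
    have h5 := hd ⟨r - 1, by omega⟩
    simp only at h4 ⊢
    omega
  · funext i
    have h0 : (i : ℕ) ≤ e i := by
      have := add_le_add_of_strictMono he (i := ⟨0, i.pos⟩) (j := i) (Fin.mk_le_mk.2 (Nat.zero_le _))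
      simp only at this
      omega
    have h1 : lam.rowLen (r - 1 - i) = e i - i := by
      refine eq_of_forall_lt_iff fun j => ?_
      rw [← YoungDiagram.mem_iff_lt_rowLen, hmem]
      constructor
      · rintro ⟨-, i', h2, h3⟩
        obtain rfl : i' = i := Fin.ext (by omega)
        omega
      · intro hj
        have := hd i
        exact ⟨⟨by omega, by omega⟩, i, by omega, by omega⟩
    rw [degreeSeq, h1]
    omega

/-- A sequence with more terms below every bound is termwise smaller. -/
theorem le_of_card_filter_le {e e' : Fin r → ℕ} (he : StrictMono e) (he' : StrictMono e')
    (h : ∀ k, (Finset.univ.filter fun i => e' i < k).card ≤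
      (Finset.univ.filter fun i => e i < k).card) (i : Fin r) : e i ≤ e' i := by
  by_contra! hlt
  have h1 : Finset.Iic i ⊆ Finset.univ.filter fun j => e' j < e' i + 1 := fun j hj =>
    Finset.mem_filter.2 ⟨Finset.mem_univ j,
      Nat.lt_succ_of_le (he'.monotone (Finset.mem_Iic.1 hj))⟩
  have h2 : (Finset.univ.filter fun j => e j < e' i + 1) ⊆ Finset.Iio i := fun j hj =>
    Finset.mem_Iio.2 (he.lt_iff_lt.1
      ((Nat.lt_succ_iff.1 (Finset.mem_filter.1 hj).2).trans_lt hlt))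
  have h3 := ((Finset.card_le_card h1).trans (h _)).trans (Finset.card_le_card h2)
  rw [Fin.card_Iic, Fin.card_Iio] at h3
  omega

theorem le_of_degreeSeq_le {c : ℕ} {lam mu : YoungDiagram} (hlam : FitsIn r c lam)
    (h : ∀ i, degreeSeq r lam i ≤ degreeSeq r mu i) : lam ≤ mu := by
  rintro ⟨a, b⟩ hx
  have h1 := (hlam _ hx).1
  have h2 := h ⟨r - 1 - a, by omega⟩
  have h3 : r - 1 - (r - 1 - a) = a := by omega
  simp only [degreeSeq, h3] at h2
  have h4 := YoungDiagram.mem_iff_lt_rowLen.1 hx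
  exact YoungDiagram.mem_iff_lt_rowLen.2 (by omega)

/-! ### Schubert cells and the Wronskian -/

/-- The Schubert conditions at infinity persist, as inequalities, on the Schubert variety. -/
theorem card_le_finrank_of_mem_schubertVariety {mu : YoungDiagram} (hmu : FitsIn r (d - r) mu)
    {W : Gr r d} (hW : W ∈ schubertVariety r d (compl r (d - r) mu) ∞) (k : ℕ) :
    (Finset.univ.filter fun i => degreeSeq r mu i < k).card ≤
      Module.finrank ℂ (W.carrier ⊓ degreeLT ℂ k : Submodule ℂ ℂ[X]) := by
  refine closure_minimal ?_ (isClosed_le_finrank_inf_degreeLT k _) hW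
  intro W' hW'
  rw [← card_schubert_condition hmu]
  exact (hW' k).ge

/-- Every `W` lies in the Schubert cell at infinity of the complement of a partition `lam`; the
Wronskian of `W` has degree `|lam|`, and `lam ⊆ mu` whenever `W` lies in the Schubert variety of
the complement of `mu`. -/
theorem exists_mem_schubertCell (A : Frame r d) : ∃ lam : YoungDiagram,
    FitsIn r (d - r) lam ∧ spanGr A ∈ schubertCell r d (compl r (d - r) lam) ∞ ∧
    (wronskiDet fun i => polyOfCoeffs d (A.1 i)) ≠ 0 ∧
    (wronskiDet fun i => polyOfCoeffs d (A.1 i)).natDegree = lam.card ∧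
    ∀ mu, FitsIn r (d - r) mu → spanGr A ∈ schubertVariety r d (compl r (d - r) mu) ∞ →
      lam ≤ mu := by
  obtain ⟨e, he, hed, hdim, f, hf⟩ := exists_degree_sequence (spanGr A)
  obtain ⟨lam, hlam, rfl⟩ := exists_degreeSeq_eq he hed
  have hfe : (fun i => (f i).natDegree) = degreeSeq r lam := funext fun i => (hf i).2.2
  obtain ⟨h1, h2⟩ := wronskiDet_frame A (fun i => ⟨(hf i).1, (hf i).2.1⟩)
    (hfe ▸ he.injective)
  refine ⟨lam, hlam, ?_, h1, ?_, ?_⟩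
  · intro k
    rw [card_schubert_condition hlam]
    exact hdim k
  · rw [hfe, sum_degreeSeq hlam] at h2
    omega
  · intro mu hmu hW
    refine le_of_degreeSeq_le hlam (le_of_card_filter_le he (degreeSeq_strictMono mu) fun k => ?_)
    rw [← hdim]
    exact card_le_finrank_of_mem_schubertVariety hmu hW k

/-- The Wronskian vanishes at `z` if the subspace has a nonzero member divisible by
`(u - z) ^ r`. -/
theorem plucker_jetMatrix_eq_zero (A : Frame r d) {z : ℂ} {f : ℂ[X]}
    (hf : f ∈ (spanGr A).carrier) (hf0 : f ≠ 0) (hdvd : (X - C z) ^ r ∣ f) :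
    plucker (jetMatrix r d z) A.1 = 0 := by
  obtain ⟨a, ha⟩ := (Submodule.mem_span_range_iff_exists_fun ℂ).1 hf
  have ha0 : a ≠ 0 := by
    rintro rfl
    exact hf0 (by rw [← ha]; simp)
  refine Matrix.exists_vecMul_eq_zero_iff.1 ⟨a, ha0, funext fun j => ?_⟩
  have h1 : (derivative^[(j : ℕ)] f).IsRoot z :=
    isRoot_iterate_derivative_of_lt_rootMultiplicity
      (j.2.trans_le ((le_rootMultiplicity_iff hf0).2 hdvd))
  rw [IsRoot.def, ← ha, iterate_derivative_sum, eval_finsetSum] at h1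
  rw [Pi.zero_apply, ← h1, Matrix.vecMul, dotProduct]
  refine Finset.sum_congr rfl fun i _ => ?_
  rw [of_mul_jetMatrix, iterate_derivative_smul, eval_smul, smul_eq_mul]

/-- The Wronskian of a subspace in the Schubert variety of a single box at `z` vanishes at `z`. -/
theorem plucker_eq_zero_of_mem_schubertVariety (hr : 0 < r) (hrd : r < d) {z : ℂ} (A : Frame r d)
    (hA : spanGr A ∈ schubertVariety r d box (z : OnePoint ℂ)) :
    plucker (jetMatrix r d z) A.1 = 0 := by
  have hiff : ∀ A : Frame r d,
      pairing (jetMatrix r d z) (jetMatrix r d z) (spanGr A) = 0 ↔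
        plucker (jetMatrix r d z) A.1 = 0 := by
    intro A
    rw [pairing_spanGr, div_eq_zero_iff, mul_eq_zero, _root_.map_eq_zero, or_self,
      Complex.ofReal_eq_zero, or_iff_left (minorNorm_pos A.2).ne']
  rw [← hiff]
  refine closure_minimal (t := {W | pairing (jetMatrix r d z) (jetMatrix r d z) W = 0}) ?_
    (isClosed_eq (continuous_pairing _ _) continuous_const) hA
  intro W hW
  obtain ⟨B, rfl⟩ := spanGr_surjective W
  refine (hiff B).2 ?_
  have hbox : box.rowLen 0 = 1 := by
    refine eq_of_forall_lt_iff fun j => ?_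
    rw [← YoungDiagram.mem_iff_lt_rowLen, ← YoungDiagram.mem_cells]
    simp [box]
  have h1 := hW (d - r)
  have h2 : 0 < ((Finset.range r).filter fun s =>
      d - r + (s + 1) - box.rowLen s ≤ d - r).card := by
    refine Finset.card_pos.2 ⟨0, Finset.mem_filter.2 ⟨Finset.mem_range.2 hr, ?_⟩⟩
    rw [hbox]
    omega
  rw [← h1] at h2
  have := Module.nontrivial_of_finrank_pos h2
  obtain ⟨⟨f, hf⟩, hf0⟩ := exists_ne (0 : ((spanGr B).carrier ⊓ oscFlag d z (d - r) :
    Submodule ℂ ℂ[X]))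
  obtain ⟨q, -, hq⟩ := Submodule.mem_map.1 hf.2
  refine plucker_jetMatrix_eq_zero B hf.1 (fun h => hf0 (Subtype.ext h)) ⟨q, ?_⟩
  rw [← hq, LinearMap.mulLeft_apply, Nat.sub_sub_self hrd.le]

/-! ### Finiteness of the fibres of the Wronski map -/

/-- A generalized Plücker coordinate as a polynomial in the entries of the frame. -/
noncomputable def pluckerPoly (E : Matrix (Fin d) (Fin r) ℂ) : MvPolynomial (Fin r × Fin d) ℂ :=
  (Matrix.of fun i j : Fin r =>
    ∑ k, MvPolynomial.X (R := ℂ) (i, k) * MvPolynomial.C (E k j)).det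

theorem aeval_pluckerPoly (E : Matrix (Fin d) (Fin r) ℂ) (x : Fin r × Fin d → ℂ) :
    MvPolynomial.aeval x (pluckerPoly E) = plucker E fun i k => x (i, k) := by
  rw [pluckerPoly, AlgHom.map_det, plucker]
  congr 1
  ext i j
  simp [Matrix.mul_apply]

theorem wronskiDet_ne_zero (A : Frame r d) : (wronskiDet fun i => polyOfCoeffs d (A.1 i)) ≠ 0 :=
  let ⟨_, _, _, h, _⟩ := exists_mem_schubertCell A
  h

theorem natDegree_wronskiDet_le (A : Frame r d) :
    (wronskiDet fun i => polyOfCoeffs d (A.1 i)).natDegree ≤ r * (d - r) := by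
  obtain ⟨lam, hlam, -, -, h, -⟩ := exists_mem_schubertCell A
  rw [h, card_eq_sum_rowLen hlam]
  exact (Finset.sum_le_card_nsmul _ _ _ fun i _ => rowLen_le_of_fitsIn hlam i).trans (by simp)

theorem exists_eval_ne_zero {g : ℂ[X]} (hg : g ≠ 0) : ∃ c, g.eval c ≠ 0 := by
  by_contra! h
  exact hg (Polynomial.funext fun c => by rw [h, eval_zero])

/-- By compactness of the Grassmannian, the Wronskian controls the maximal minors: a frame with
given Wronskian has bounded maximal minors. -/
theorem exists_minorNorm_le (g : ℂ[X]) : ∃ R : ℝ, ∀ A : Frame r d,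
    (wronskiDet fun i => polyOfCoeffs d (A.1 i)) = g → minorNorm A.1 ≤ R := by
  -- a polynomial of degree at most `r * (d - r)` is determined by its values at these points
  let J : Fin (r * (d - r) + 1) → Matrix (Fin d) (Fin r) ℂ := fun m => jetMatrix r d ((m : ℕ) : ℂ)
  let ψ : Gr r d → ℝ := fun W => ∑ m, (pairing (J m) (J m) W).re
  have hψ : Continuous ψ :=
    continuous_finsetSum _ fun m _ => Complex.continuous_re.comp (continuous_pairing _ _)
  have hψA : ∀ A : Frame r d, ψ (spanGr A) = (∑ m, ‖plucker (J m) A.1‖ ^ 2) / minorNorm A.1 := by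
    intro A
    simp only [ψ, pairing_spanGr, Finset.sum_div]
    refine Finset.sum_congr rfl fun m _ => ?_
    rw [Complex.mul_conj, Complex.normSq_eq_norm_sq, ← Complex.ofReal_div, Complex.ofReal_re]
  have hpos : ∀ W ∈ Set.univ, 0 < ψ W := by
    intro W _
    obtain ⟨A, rfl⟩ := spanGr_surjective W
    rw [hψA]
    refine div_pos ?_ (minorNorm_pos A.2)
    refine lt_of_le_of_ne (Finset.sum_nonneg fun m _ => by positivity) fun h => ?_
    have h1 := (Finset.sum_eq_zero_iff_of_nonneg fun m _ => by positivity).1 h.symm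
    refine wronskiDet_ne_zero A (eq_zero_of_natDegree_lt_card_of_eval_eq_zero _
      (f := fun m : Fin (r * (d - r) + 1) => ((m : ℕ) : ℂ))
      (Nat.cast_injective.comp Fin.val_injective) (fun m => ?_) ?_)
    · rw [eval_wronskiDet]
      have := h1 m (Finset.mem_univ m)
      simpa using this
    · rw [Fintype.card_fin]
      exact Nat.lt_succ_of_le (natDegree_wronskiDet_le A)
  obtain ⟨ε, hε, hle⟩ := isCompact_univ.exists_forall_le' hψ.continuousOn hpos
  refine ⟨(∑ m : Fin (r * (d - r) + 1), ‖g.eval ((m : ℕ) : ℂ)‖ ^ 2) / ε, fun A hA => ?_⟩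
  have h1 := hle (spanGr A) trivial
  rw [hψA, le_div_iff₀ (minorNorm_pos A.2)] at h1
  rw [le_div_iff₀ hε, mul_comm]
  refine h1.trans_eq (Finset.sum_congr rfl fun m _ => ?_)
  rw [← hA, eval_wronskiDet]

/-- There are only finitely many subspaces with a given Wronskian. -/
theorem finite_setOf_wronskiDet_eq {g : ℂ[X]} (hg : g ≠ 0) : {W : Gr r d | ∃ A : Frame r d,
    spanGr A = W ∧ (wronskiDet fun i => polyOfCoeffs d (A.1 i)) = g}.Finite := by
  obtain ⟨R, hR⟩ := exists_minorNorm_le (r := r) (d := d) g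
  obtain ⟨c₀, hc₀⟩ := exists_eval_ne_zero hg
  -- the equations saying that the Wronskian of a matrix takes the values of `g`
  let S : Set (MvPolynomial (Fin r × Fin d) ℂ) :=
    Set.range fun c : ℂ => pluckerPoly (jetMatrix r d c) - MvPolynomial.C (g.eval c)
  have hS : ∀ x : Fin r × Fin d → ℂ, (∀ q ∈ S, MvPolynomial.aeval x q = 0) ↔
      ∀ c, plucker (jetMatrix r d c) (fun i k => x (i, k)) = g.eval c := by
    intro x
    simp only [S, Set.forall_mem_range, map_sub, aeval_pluckerPoly, MvPolynomial.aeval_C, sub_eq_zero]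
    rfl
  have hfin : ∀ c : Fin r → Fin d, {w : ℂ | ∃ x : Fin r × Fin d → ℂ,
      (∀ q ∈ S, MvPolynomial.aeval x q = 0) ∧
        MvPolynomial.aeval x (pluckerPoly (colSelect c)) = w}.Finite := by
    intro c
    refine finite_values_of_bounded S _ (Real.sqrt R) fun x hx => ?_
    rw [hS] at hx
    have hli := linearIndependent_of_plucker_ne_zero (A := fun i k => x (i, k)) (by rwa [hx c₀])
    have h1 := hR ⟨_, hli⟩ (Polynomial.funext fun a => by rw [eval_wronskiDet]; exact hx a)
    rw [aeval_pluckerPoly, plucker_colSelect]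
    refine Real.le_sqrt_of_sq_le (le_trans ?_ h1)
    exact Finset.single_le_sum (f := fun c => ‖minor c fun i k => x (i, k)‖ ^ 2)
      (fun _ _ => by positivity) (Finset.mem_univ c)
  have hne : ∀ A : Frame r d, (wronskiDet fun i => polyOfCoeffs d (A.1 i)) = g →
      (fun c => minor c A.1) ∈ Set.pi Set.univ fun c : Fin r → Fin d =>
        {w : ℂ | ∃ x : Fin r × Fin d → ℂ, (∀ q ∈ S, MvPolynomial.aeval x q = 0) ∧
          MvPolynomial.aeval x (pluckerPoly (colSelect c)) = w} := by
    intro A hA c _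
    refine ⟨fun p => A.1 p.1 p.2, (hS _).2 fun a => ?_, ?_⟩
    · rw [← hA, eval_wronskiDet]
    · rw [aeval_pluckerPoly, plucker_colSelect]
  have := (Set.Finite.pi hfin).to_subtype
  choose a ha using fun W : {W : Gr r d | ∃ A : Frame r d,
    spanGr A = W ∧ (wronskiDet fun i => polyOfCoeffs d (A.1 i)) = g} => W.2
  refine Set.finite_coe_iff.1 (Finite.of_injective
    (fun W => (⟨_, hne (a W) (ha W).2⟩ : Set.pi Set.univ fun c : Fin r → Fin d =>
        {w : ℂ | ∃ x : Fin r × Fin d → ℂ, (∀ q ∈ S, MvPolynomial.aeval x q = 0) ∧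
          MvPolynomial.aeval x (pluckerPoly (colSelect c)) = w})) fun W W' h => Subtype.ext ?_)
  rw [← (ha W).1, ← (ha W').1]
  refine spanGr_eq_of_minor_eq (κ := 1) fun c => ?_
  rw [one_mul]
  exact congrFun (Subtype.ext_iff.1 h) c

/-- A frame can be rescaled so as to multiply all its Plücker coordinates by a given nonzero
scalar. -/
theorem exists_frame_plucker_eq_mul (hr : 0 < r) (B : Frame r d) {δ : ℂ} (hδ : δ ≠ 0) :
    ∃ A : Frame r d, spanGr A = spanGr B ∧ ∀ E, plucker E A.1 = δ * plucker E B.1 := by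
  let g : Matrix (Fin r) (Fin r) ℂ := Matrix.diagonal (Function.update 1 ⟨0, hr⟩ δ)
  have hdet : g.det = δ := by
    rw [Matrix.det_diagonal, Finset.prod_update_of_mem (Finset.mem_univ _)]
    simp
  let A : Fin r → Fin d → ℂ := g * Matrix.of B.1
  have hE : ∀ E, plucker E A = δ * plucker E B.1 := fun E => by
    rw [plucker_mul E (show Matrix.of A = g * Matrix.of B.1 from rfl), hdet]
  obtain ⟨c, hc⟩ := exists_minor_ne_zero B.2
  have hli : LinearIndependent ℂ A :=
    linearIndependent_of_plucker_ne_zero (E := colSelect c)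
      (by rw [hE, plucker_colSelect]; exact mul_ne_zero hδ hc)
  exact ⟨⟨A, hli⟩, spanGr_eq_of_mul (g := g) rfl, hE⟩

/-! ### Degeneration of the last marked point to infinity -/

/-- If the Wronskian of `Y s` is proportional to `(u - s) * g` for large `s`, then the Wronskian of
every cluster point of `Y` at infinity is proportional to `g`. -/
theorem exists_wronskiDet_eq_of_mapClusterPt {Y : ℝ → Gr r d} {g : ℂ[X]} (hg : g ≠ 0)
    (hY : ∀ᶠ s : ℝ in atTop, ∀ A : Frame r d, spanGr A = Y s →
      ∃ κ : ℂ, (wronskiDet fun i => polyOfCoeffs d (A.1 i)) = C κ * (g * (X - C (s : ℂ))))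
    (B : Frame r d) (hB : MapClusterPt (spanGr B) atTop Y) :
    ∃ κ : ℂ, κ ≠ 0 ∧ (wronskiDet fun i => polyOfCoeffs d (B.1 i)) = C κ * g := by
  obtain ⟨U, hU, hUY⟩ := mapClusterPt_iff_ultrafilter.1 hB
  have hrel : ∀ c c' c'' : ℂ,
      pairing (jetMatrix r d c) (jetMatrix r d c'') (spanGr B) * (g.eval c' * (0 - 1)) =
        pairing (jetMatrix r d c') (jetMatrix r d c'') (spanGr B) * (g.eval c * (0 - 1)) := by
    -- the relation for `Y s`, divided by `s`, in the limit
    intro c c' c''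
    have hlim : ∀ a b : ℂ, Tendsto (fun s : ℝ =>
        pairing (jetMatrix r d a) (jetMatrix r d c'') (Y s) * (g.eval b * (b / (s : ℂ) - 1))) U
        (𝓝 (pairing (jetMatrix r d a) (jetMatrix r d c'') (spanGr B) *
          (g.eval b * (0 - 1)))) := by
      intro a b
      have h1 : Tendsto (fun s : ℝ => b / (s : ℂ)) atTop (𝓝 0) := by
        have := (Complex.continuous_ofReal.tendsto 0).comp (tendsto_inv_atTop_zero (𝕜 := ℝ))
        simpa [div_eq_mul_inv, Function.comp_def] using this.const_mul b
      exact (((continuous_pairing _ _).tendsto _).comp hUY).mul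
        (((h1.mono_left hU).sub_const 1).const_mul _)
    refine tendsto_nhds_unique_of_eventuallyEq (hlim c c') (hlim c' c) ?_
    filter_upwards [hU hY, hU (eventually_gt_atTop 0)] with s hs hs0
    obtain ⟨A, hA⟩ := spanGr_surjective (Y s)
    obtain ⟨κ, hκ⟩ := hs A hA
    have hval : ∀ a, plucker (jetMatrix r d a) A.1 = κ * (g.eval a * (a - s)) := fun a => by
      rw [← eval_wronskiDet, hκ]
      simp
    have hs1 : (s : ℂ) ≠ 0 := Complex.ofReal_ne_zero.2 (ne_of_gt hs0)
    simp only [← hA, pairing_spanGr, hval]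
    field_simp
  obtain ⟨c'', hc''⟩ := exists_eval_ne_zero (wronskiDet_ne_zero B)
  obtain ⟨c', hc'⟩ := exists_eval_ne_zero hg
  rw [eval_wronskiDet] at hc''
  have hN : (minorNorm B.1 : ℂ) ≠ 0 := Complex.ofReal_ne_zero.2 (minorNorm_pos B.2).ne'
  have hconj : starRingEnd ℂ (plucker (jetMatrix r d c'') B.1) ≠ 0 := (_root_.map_ne_zero _).2 hc''
  have heq : (wronskiDet fun i => polyOfCoeffs d (B.1 i)) =
      C (plucker (jetMatrix r d c') B.1 / g.eval c') * g := by
    refine Polynomial.funext fun c => ?_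
    have h1 := hrel c c' c''
    rw [pairing_spanGr, pairing_spanGr] at h1
    field_simp at h1
    rw [eval_wronskiDet, eval_mul, eval_C, div_mul_eq_mul_div, eq_div_iff hc']
    linear_combination h1
  refine ⟨_, fun h => wronskiDet_ne_zero B ?_, heq⟩
  rw [heq, h, C_0, zero_mul]

/-- A subspace in an intersection of Schubert varieties of `|mu|` single boxes at distinct points
with the Schubert variety of the complement of `mu` at infinity has Wronskian proportional to the
polynomial with simple roots at these points. -/
theorem wronskiDet_eq_of_mem_schubertIntersection {m : ℕ} {mu : YoungDiagram}
    (hfit : FitsIn r (d - r) mu) (hmu : mu.card = m) (hr : 0 < r) (hrd : r < d) {w : Fin m → ℂ}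
    (hw : Function.Injective w) (A : Frame r d)
    (hA : spanGr A ∈ schubertIntersection r d mu w) :
    ∃ κ : ℂ, (wronskiDet fun i => polyOfCoeffs d (A.1 i)) = C κ * ∏ i, (X - C (w i)) := by
  obtain ⟨lam, -, -, h0, hdeg, hle⟩ := exists_mem_schubertCell A
  have hcard : lam.card ≤ mu.card :=
    Finset.card_le_card (YoungDiagram.cells_subset_iff.2 (hle mu hfit hA.2))
  refine ⟨_, eq_leadingCoeff_mul_of_monic_of_dvd_of_natDegree_le
    (monic_prod_of_monic _ _ fun i _ => monic_X_sub_C _) ?_ ?_⟩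
  · refine Finset.prod_dvd_of_coprime (fun i _ j _ hij => pairwise_coprime_X_sub_C hw hij)
      fun i _ => ?_
    rw [dvd_iff_isRoot, IsRoot.def, eval_wronskiDet]
    exact plucker_eq_zero_of_mem_schubertVariety hr hrd A (Set.mem_iInter.1 hA.1 i)
  · rw [natDegree_finsetProd_X_sub_C_eq_card, hdeg, Finset.card_univ, Fintype.card_fin, ← hmu]
    exact hcard

end SchubertLimit

/-- Here `z = (z 0, …, z n)` are the (`n + 1`) marked points, and `X s` is a continuous section,
with `X (z n) = X₀`, of the family of intersections obtained by letting the last point be `s`. -/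
theorem mainTheorem3 (r d n : ℕ) (mu : YoungDiagram)
    (hfit : SchubertLimit.FitsIn r (d - r) mu) (hmu : mu.card = n + 1)
    (z : Fin (n + 1) → ℝ) (hz : StrictMono z)
    (X₀ : SchubertLimit.Gr r d)
    (hX₀ : X₀ ∈ SchubertLimit.schubertIntersection r d mu (fun i => (z i : ℂ)))
    (X : ℝ → SchubertLimit.Gr r d) (hstart : X (z (Fin.last n)) = X₀)
    (hcont : ContinuousOn X (Set.Ici (z (Fin.last n))))
    (hX : ∀ s ∈ Set.Ici (z (Fin.last n)),
      X s ∈ SchubertLimit.schubertIntersection r d mu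
        (fun i => ((Function.update z (Fin.last n) s i : ℝ) : ℂ))) :
    ∃ Xinf : SchubertLimit.Gr r d,
      Tendsto X atTop (𝓝 Xinf) ∧
      ∃ lam : YoungDiagram, lam ≤ mu ∧ lam.card + 1 = mu.card ∧
        Xinf ∈ SchubertLimit.schubertCell r d (SchubertLimit.compl r (d - r) lam) ∞ ∧
        Xinf ∈ SchubertLimit.schubertIntersection r d lam
          (fun i : Fin n => (z i.castSucc : ℂ)) := by
  open SchubertLimit in
  obtain ⟨x, hx⟩ : mu.cells.Nonempty := Finset.card_pos.1 (by rw [YoungDiagram.card] at hmu; omega)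
  have hx' := hfit x ((YoungDiagram.mem_cells x).1 hx)
  have hr : 0 < r := by omega
  have hrd : r < d := by omega
  -- the Wronskian of the limit, up to a scalar
  set g : ℂ[X] := ∏ i : Fin n, (Polynomial.X - C (z i.castSucc : ℂ)) with hg
  have hgmonic : g.Monic := monic_prod_of_monic _ _ fun i _ => monic_X_sub_C _
  have hg0 : g ≠ 0 := hgmonic.ne_zero
  have hgdeg : g.natDegree = n := by
    rw [hg, natDegree_finsetProd_X_sub_C_eq_card, Finset.card_univ, Fintype.card_fin]
  have hwr : ∀ᶠ s : ℝ in atTop, ∀ A : Frame r d, spanGr A = X s → ∃ κ : ℂ,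
      (wronskiDet fun i => polyOfCoeffs d (A.1 i)) = C κ * (g * (Polynomial.X - C (s : ℂ))) := by
    filter_upwards [eventually_ge_atTop (z (Fin.last n))] with s hs A hA
    have hinj : Function.Injective fun i : Fin (n + 1) =>
        ((Function.update z (Fin.last n) s i : ℝ) : ℂ) := by
      refine Complex.ofReal_injective.comp (StrictMono.injective fun i j hij => ?_)
      have hi : i ≠ Fin.last n := (hij.trans_le (Fin.le_last j)).ne
      rw [Function.update_of_ne hi]
      by_cases hj : j = Fin.last n
      · subst hj
        rw [Function.update_self]
        exact (hz hij).trans_le hs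
      · rw [Function.update_of_ne hj]
        exact hz hij
    obtain ⟨κ, hκ⟩ := wronskiDet_eq_of_mem_schubertIntersection hfit hmu hr hrd hinj A
      (hA ▸ hX s hs)
    refine ⟨κ, ?_⟩
    rw [hκ, Fin.prod_univ_castSucc]
    simp [hg, (Fin.castSucc_lt_last _).ne]
  have hfinite : {Y | MapClusterPt Y atTop X}.Finite := by
    refine (finite_setOf_wronskiDet_eq hg0).subset fun Y hY => ?_
    obtain ⟨B, rfl⟩ := spanGr_surjective Y
    obtain ⟨κ, hκ, hB⟩ := exists_wronskiDet_eq_of_mapClusterPt hg0 hwr B hY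
    -- rescaling a frame makes its Wronskian equal to `g`
    obtain ⟨A, hAB, hA⟩ := exists_frame_plucker_eq_mul hr B (inv_ne_zero hκ)
    refine ⟨A, hAB, Polynomial.funext fun c => ?_⟩
    rw [eval_wronskiDet, hA, ← eval_wronskiDet, hB, eval_mul, eval_C, inv_mul_cancel_left₀ hκ]
  obtain ⟨Xinf, hlim⟩ := exists_tendsto_of_finite_clusterPts hcont hfinite
  obtain ⟨B, rfl⟩ := spanGr_surjective Xinf
  obtain ⟨κ, hκ, hB⟩ := exists_wronskiDet_eq_of_mapClusterPt hg0 hwr B hlim.mapClusterPt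
  obtain ⟨lam, -, hcell, -, hdeg, hle⟩ := exists_mem_schubertCell B
  refine ⟨spanGr B, hlim, lam, hle mu hfit ?_, ?_, hcell, Set.mem_iInter.2 fun i => ?_,
    subset_closure hcell⟩
  · refine isClosed_closure.mem_of_tendsto hlim ?_
    filter_upwards [eventually_ge_atTop (z (Fin.last n))] with s hs
    exact (hX s hs).2
  · rw [hmu, ← hdeg, hB, natDegree_C_mul hκ, hgdeg]
  · refine isClosed_closure.mem_of_tendsto hlim ?_
    filter_upwards [eventually_ge_atTop (z (Fin.last n))] with s hs
    have h := Set.mem_iInter.1 (hX s hs).1 i.castSucc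
    beta_reduce at h
    rwa [Function.update_of_ne (Fin.castSucc_lt_last i).ne] at h
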